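/- Let $\mathbb N=\{0,1,2,\dots\}$, let $\mathbf A:\mathbb N\times\mathbb N\to\{0,1\}$, and let $\Sigma_{\mathbf A}(\mathbb N)=\{x\in\mathbb N^{\mathbb N}:\mathbf A(x_i,x_{i+1})=1\ \forall i\ge 0\}$, with the product topology and the shift $(\sigma x)_i=x_{i+1}$. A (possibly empty) word $w=w_1\dots w_k$ connects $i$ to $j$ if every two consecutive symbols $a,b$ of $i\,w_1\dots w_k\,j$ satisfy $\mathbf A(a,b)=1$. For $S\subset\mathbb N$, the restriction $\mathbf A|_{S\times S}$ is irreducible if any two symbols of $S$ are connected by a word with symbols in $S$. Put $\Sigma_{\mathbf A}(S)=\{x\in\Sigma_{\mathbf A}(\mathbb N): x_i\in S\ \forall i\}$, and let $\mathcal M_\sigma(\Sigma_{\mathbf A}(S))$ be the set of $\sigma$-invariant Borel probability measures on it. Write $[j]=\{x\in\Sigma_{\mathbf A}(\mathbb N):x_0=j\}$. Let $\mathbf A$ be irreducible, and let $f:\Sigma_{\mathbf A}(\mathbb N)\to\mathbb R$ have bounded variation, that is, $V(f)=\sum_{j\ge1}V_j(f)<\infty$, where $V_j(f)=\sup\{f(x)-f(y):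 x_i=y_i \text{ for } 0\le i<j\}$. Suppose that $$\beta=\sup_{\mu\in\mathcal M_\sigma(\Sigma_{\mathbf A}(\mathbb N))}\int f\,d\mu$$ is finite (the integrals may be $-\infty$). Let $\epsilon>0$, and let $I_2>I_1>0$ be naturals. For all $i,j<I_1$ fix a word $w(i,j)$ connecting $i$ to $j$, let $P_0$ be the greatest length of these words, let $\mathcal A_1$ be the finite set consisting of $0,\dots,I_1-1$ and of all symbols of these words, and set $$C_1=-\Big(P_0\,\big|\min f|_{\Sigma_{\mathbf A}(\mathcal A_1)}\big|+(P_0-1)|\beta|+2V(f)\Big),\qquad C_2=\beta-\epsilon-V(f),\qquad C=\min\{C_1,C_2\}.$$ Assume that $\sup f|_{[j]}<\beta-\epsilon$ for all $j\ge I_1$ and $\sup f|_{[j]}<C$ for all $j\ge I_2$. Then there is a finite set $\mathcal A\subset\mathbb N$ such that $\mathbf A|_{\mathcal A\times\mathcal A}$ is irreducible and $$\beta=\sup_{\mu\in\mathcal M_\sigma(\Sigma_{\mathbf A}(\mathcal A))}\int f\,d\mu .$$ Furthermore, every $\nu\in\mathcal M_\sigma(\Sigma_{\mathbf A}(\mathbb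 N))$ with $\int f\,d\nu=\beta$ satisfies $\operatorname{supp}\nu\subset\Sigma_{\mathbf A}(\mathcal A)$. -/

import Mathlib

open MeasureTheory

namespace CountableMarkov

/-- `Σ_A(ℕ)`: the one-sided sequences of naturals allowed by the `0`-`1` matrix `A`. As a subtype
of `ℕ → ℕ` it carries the product topology (that of the metrics `d(x,y) = λ^k`, with `k` the first
coordinate where `x` and `y` differ) and its Borel σ-algebra. -/
abbrev Shift (A : ℕ → ℕ → Fin 2) : Type :=
  {x : ℕ → ℕ // ∀ i, A (x i) (x (i + 1)) = 1}

/-- The shift map `(σ x)_i = x_{i+1}`. -/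
def shiftMap (A : ℕ → ℕ → Fin 2) (x : Shift A) : Shift A :=
  ⟨fun i => x.1 (i + 1), fun i => x.2 (i + 1)⟩

/-- The word `w` (possibly empty) connects `i` to `j`: the word `i w j` is allowable. -/
def Connects (A : ℕ → ℕ → Fin 2) (i : ℕ) (w : List ℕ) (j : ℕ) : Prop :=
  List.IsChain (fun a b => A a b = 1) (i :: (w ++ [j]))

/-- The restriction of `A` to `S × S` is irreducible: any two symbols of `S` are connected by a word
in the alphabet `S`. (Asking for a nonempty word is the same: an empty word from `i` to `j` can be
replaced by `j` followed by a word connecting `j` to `j`.) -/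
def IrreducibleOn (A : ℕ → ℕ → Fin 2) (S : Set ℕ) : Prop :=
  ∀ i ∈ S, ∀ j ∈ S, ∃ w : List ℕ, (∀ s ∈ w, s ∈ S) ∧ Connects A i w j

/-- `Σ_A(S)`: the allowable sequences of symbols in `S`, as a subset of `Σ_A(ℕ)`. -/
def subshift (A : ℕ → ℕ → Fin 2) (S : Set ℕ) : Set (Shift A) :=
  {x | ∀ i, x.1 i ∈ S}

/-- The `j`-th variation: the supremum of `f x - f y` over all `x`, `y` whose first `j`
coordinates agree, as an extended nonnegative real (the pairs with `x = y` contribute `0`). -/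
noncomputable def variation {A : ℕ → ℕ → Fin 2} (f : Shift A → ℝ) (j : ℕ) : ENNReal :=
  ⨆ (x : Shift A) (y : Shift A) (_ : ∀ i < j, x.1 i = y.1 i), ENNReal.ofReal (f x - f y)

/-- `V(f) = ∑_{j ≥ 1} V_j(f)`. The function `f` has bounded variation when this is finite. -/
noncomputable def totalVariation {A : ℕ → ℕ → Fin 2} (f : Shift A → ℝ) : ENNReal :=
  ∑' j : ℕ, variation f (j + 1)

/-- `sup f|_[j]`, the supremum of `f` over the cylinder of the sequences beginning with `j`. -/
noncomputable def cylinderSup {A : ℕ → ℕ → Fin 2} (f : Shift A → ℝ) (j : ℕ) : EReal :=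
  ⨆ (x : Shift A) (_ : x.1 0 = j), (f x : EReal)

/-- The shift-invariant Borel probability measures on `Σ_A(ℕ)`. -/
def invariantMeasures (A : ℕ → ℕ → Fin 2) : Set (Measure (Shift A)) :=
  {μ | IsProbabilityMeasure μ ∧ MeasurePreserving (shiftMap A) μ μ}

/-- The shift-invariant Borel probability measures on `Σ_A(S)`, seen as the invariant probability
measures on `Σ_A(ℕ)` that give no mass to the complement of `Σ_A(S)`. -/
def invariantMeasuresOn (A : ℕ → ℕ → Fin 2) (S : Set ℕ) : Set (Measure (Shift A)) :=
  {μ | μ ∈ invariantMeasures A ∧ μ (subshift A S)ᶜ = 0}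

/-- The extended-real integral `∫ f⁺ dμ - ∫ f⁻ dμ`. For `f` bounded above it is the usual integral
with values in `[-∞, ∞)`. -/
noncomputable def extIntegral {A : ℕ → ℕ → Fin 2} (f : Shift A → ℝ) (μ : Measure (Shift A)) :
    EReal :=
  ((∫⁻ x, ENNReal.ofReal (f x) ∂μ : ENNReal) : EReal) -
    ((∫⁻ x, ENNReal.ofReal (-f x) ∂μ : ENNReal) : EReal)

/-- The supremum of `∫ f dμ` over all shift-invariant Borel probability measures on `Σ_A(ℕ)`. -/
noncomputable def supIntegral {A : ℕ → ℕ → Fin 2} (f : Shift A → ℝ) : EReal :=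
  ⨆ μ ∈ invariantMeasures A, extIntegral f μ

/-- The supremum of `∫ f dμ` over all shift-invariant Borel probability measures on `Σ_A(S)`. -/
noncomputable def supIntegralOn {A : ℕ → ℕ → Fin 2} (f : Shift A → ℝ) (S : Set ℕ) : EReal :=
  ⨆ μ ∈ invariantMeasuresOn A S, extIntegral f μ

/-- `P₀`: the length of the longest of the chosen words `w i j` with `i, j < I`. -/
def maxWordLength (w : ℕ → ℕ → List ℕ) (I : ℕ) : ℕ :=
  (Finset.range I ×ˢ Finset.range I).sup fun p => (w p.1 p.2).length

/-- `𝒜₁`: the symbols `0, …, I - 1` and all symbols of the chosen words `w i j` with `i, j < I`. -/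
def completedAlphabet (w : ℕ → ℕ → List ℕ) (I : ℕ) : Finset ℕ :=
  Finset.range I ∪ (Finset.range I ×ˢ Finset.range I).biUnion fun p => (w p.1 p.2).toFinset

/-- `min f|_{Σ_A(S)}`. It is used for a finite `S` with `A` irreducible on `S` and for `f` of
bounded variation only, where the infimum is attained. -/
noncomputable def minOn {A : ℕ → ℕ → Fin 2} (f : Shift A → ℝ) (S : Set ℕ) : ℝ :=
  sInf (f '' subshift A S)

/-- `C₁ = -(P₀ |min f|_{Σ_A(𝒜₁)}| + (P₀ - 1) |β| + 2 V(f))`. -/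
noncomputable def constC₁ {A : ℕ → ℕ → Fin 2} (f : Shift A → ℝ) (β : ℝ)
    (w : ℕ → ℕ → List ℕ) (I : ℕ) : ℝ :=
  -((maxWordLength w I : ℝ) * |minOn f (completedAlphabet w I : Set ℕ)|
    + ((maxWordLength w I : ℝ) - 1) * |β| + 2 * (totalVariation f).toReal)

/-- `C₂ = β - ε - V(f)`. -/
noncomputable def constC₂ {A : ℕ → ℕ → Fin 2} (f : Shift A → ℝ) (β ε : ℝ) : ℝ :=
  β - ε - (totalVariation f).toReal

/-- `C = min {C₁, C₂}`. -/
noncomputable def constC {A : ℕ → ℕ → Fin 2} (f : Shift A → ℝ) (β ε : ℝ)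
    (w : ℕ → ℕ → List ℕ) (I : ℕ) : ℝ :=
  min (constC₁ f β w I) (constC₂ f β ε)

end CountableMarkov

open CountableMarkov

namespace CountableMarkov

open Filter Topology

variable {A : ℕ → ℕ → Fin 2}

/-! ### Points of the shift -/

/-! The finite alphabet is obtained by completing `{0, …, I₂ - 1}` with connecting words, keeping
the prescribed words below `I₁`; call it `S`. For `β - ε ≤ b ≤ β`, the function `f - b` is negative
on cylinders of symbols `≥ I₁`. The constant `C` is chosen so that an excursion above `I₁` which
visits a symbol `≥ I₂` loses more than the connecting word that bypasses it (`exists_replacement`).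

Suppose `f - b` has nonpositive sum along every periodic orbit in `Σ_A(S)`. By bypassing such
excursions and closing up with a connecting word, every path starting at the symbol `0` has a
Birkhoff sum bounded above. Hence `φ(x)`, the supremum of these sums over all paths from `0` that
end at `x`, is finite, and extending paths by one step gives `φ + (f - b) ≤ φ ∘ σ`
(`exists_subaction`). Integrating, with truncations and Fatou since `φ` need not be integrable,
gives `∫ f dν ≤ b` for every invariant `ν` (`extIntegral_le_of_subaction`).

If the supremum over `Σ_A(S)` were below `β`, some `b < β` would be admissible, contradicting the
definition of `β`. Taking `b = β`, a maximizing `ν` satisfies the sub-action inequality with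
equality almost everywhere. The inequality is strict across an excursion reaching `I₂`, so with
Poincaré recurrence almost every orbit uses only symbols below `I₂` (`lt_of_frequently`). No
maximizing measure has to be constructed. -/

theorem iterate_shiftMap_apply (x : Shift A) (n i : ℕ) :
    ((shiftMap A)^[n] x).1 i = x.1 (n + i) := by
  induction n generalizing x with
  | zero => simp
  | succ n ih =>
    rw [Function.iterate_succ_apply, ih]
    rw [show n + 1 + i = n + i + 1 by omega]
    rfl

/-- The point `a z₀ z₁ …`. -/
def consPoint (a : ℕ) (z : Shift A) (h : A a (z.1 0) = 1) : Shift A :=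
  ⟨fun n => Nat.casesOn n a z.1, fun i => by cases i with
    | zero => exact h
    | succ i => exact z.2 i⟩

/-- The point `y₀ … yₙ₋₁ z₀ z₁ …`, for `yₙ = z₀`. -/
def splice (y : Shift A) (n : ℕ) (z : Shift A) (h : y.1 n = z.1 0) : Shift A :=
  ⟨fun i => if i < n then y.1 i else z.1 (i - n), fun i => by
    rcases lt_trichotomy (i + 1) n with hi | hi | hi
    · simp only [show i < n by omega, hi, if_true]
      exact y.2 i
    · subst hi
      simp only [Nat.lt_succ_self, if_true, lt_irrefl, if_false, Nat.sub_self, ← h]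
      exact y.2 i
    · simp only [show ¬ i < n by omega, show ¬ i + 1 < n by omega, if_false]
      rw [show i + 1 - n = i - n + 1 by omega]
      exact z.2 _⟩

theorem splice_apply_of_le {y : Shift A} {n : ℕ} {z : Shift A} (h : y.1 n = z.1 0) {i : ℕ}
    (hi : i ≤ n) : (splice y n z h).1 i = y.1 i := by
  rcases hi.lt_or_eq with hi | rfl
  · simp [splice, hi]
  · simp [splice, h]

theorem splice_apply_add {y : Shift A} {n : ℕ} {z : Shift A} (h : y.1 n = z.1 0) (i : ℕ) :
    (splice y n z h).1 (n + i) = z.1 i := by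
  simp [splice]

theorem iterate_splice {y : Shift A} {n : ℕ} {z : Shift A} (h : y.1 n = z.1 0) :
    (shiftMap A)^[n] (splice y n z h) = z := by
  apply Subtype.ext
  funext i
  rw [iterate_shiftMap_apply, splice_apply_add]

/-- The periodic point repeating `y₀ … y_{N-1}`, for `y_N = y₀`. -/
def cyclePoint (y : Shift A) (N : ℕ) (hN : 0 < N) (h : y.1 N = y.1 0) : Shift A :=
  ⟨fun i => y.1 (i % N), fun i => by
    have hlt : i % N < N := Nat.mod_lt i hN
    have key : y.1 ((i + 1) % N) = y.1 (i % N + 1) := by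
      rw [Nat.add_mod_eq_ite]
      rcases Nat.lt_or_ge 1 N with h1 | h1
      · rw [Nat.mod_eq_of_lt h1]
        split_ifs with h2
        · rw [show i % N + 1 = N by omega, Nat.sub_self, h]
        · rfl
      · obtain rfl : N = 1 := by omega
        simp [Nat.mod_one, h]
    simpa only [key] using y.2 _⟩

theorem cyclePoint_apply {y : Shift A} {N : ℕ} (hN : 0 < N) (h : y.1 N = y.1 0) (i : ℕ) :
    (cyclePoint y N hN h).1 i = y.1 (i % N) := rfl

theorem iterate_cyclePoint {y : Shift A} {N : ℕ} (hN : 0 < N) (h : y.1 N = y.1 0) :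
    (shiftMap A)^[N] (cyclePoint y N hN h) = cyclePoint y N hN h := by
  apply Subtype.ext
  funext i
  rw [iterate_shiftMap_apply, cyclePoint_apply, cyclePoint_apply, Nat.add_mod_left]

theorem connects_cons {i a j : ℕ} {w : List ℕ} :
    Connects A i (a :: w) j ↔ A i a = 1 ∧ Connects A a w j := by
  simp [Connects, List.isChain_cons_cons]

theorem connects_nil {i j : ℕ} : Connects A i [] j ↔ A i j = 1 := by
  simp [Connects]

theorem connects_append_cons {i a j : ℕ} {u v : List ℕ} :
    Connects A i (u ++ a :: v) j ↔ Connects A i u a ∧ Connects A a v j := by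
  induction u generalizing i with
  | nil => simp [connects_cons, connects_nil]
  | cons b u ih => simp [connects_cons, ih, and_assoc]

theorem exists_point_of_connects {i j : ℕ} {w : List ℕ} (hw : Connects A i w j) {z : Shift A}
    (hz : z.1 0 = j) :
    ∃ u : Shift A, u.1 0 = i ∧ (∀ k < w.length, u.1 (k + 1) ∈ w) ∧
      (shiftMap A)^[w.length + 1] u = z := by
  induction w generalizing i with
  | nil =>
    refine ⟨consPoint i z (by rw [hz]; exact connects_nil.1 hw), rfl, by simp, rfl⟩
  | cons a w ih =>
    obtain ⟨hia, haw⟩ := connects_cons.1 hw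
    obtain ⟨u, hu0, hum, huz⟩ := ih haw
    refine ⟨consPoint i u (by rw [hu0]; exact hia), rfl, ?_, ?_⟩
    · intro k hk
      cases k with
      | zero => change u.1 0 ∈ _; simp [hu0]
      | succ k => exact List.mem_cons_of_mem _ (hum k (by simpa using hk))
    · rw [← huz]
      rfl

theorem exists_point_start (hA : IrreducibleOn A Set.univ) (j : ℕ) :
    ∃ z : Shift A, z.1 0 = j := by
  have hs : ∀ a, ∃ b, A a b = 1 := by
    intro a
    obtain ⟨w, -, hw⟩ := hA a trivial a trivial
    cases w with
    | nil => exact ⟨a, connects_nil.1 hw⟩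
    | cons b w => exact ⟨b, (connects_cons.1 hw).1⟩
  choose g hg using hs
  exact ⟨⟨fun n => g^[n] j, fun i => by simpa only [Function.iterate_succ_apply'] using hg _⟩, rfl⟩

/-! ### Variation -/

theorem sub_le_variation {f : Shift A → ℝ} (hf : totalVariation f ≠ ⊤) {j : ℕ} {x y : Shift A}
    (h : ∀ i < j + 1, x.1 i = y.1 i) : f x - f y ≤ (variation f (j + 1)).toReal := by
  have h1 : ENNReal.ofReal (f x - f y) ≤ variation f (j + 1) :=
    le_iSup_of_le x (le_iSup_of_le y (le_iSup_of_le h le_rfl))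
  exact (ENNReal.ofReal_le_iff_le_toReal (ENNReal.ne_top_of_tsum_ne_top hf j)).1 h1

theorem summable_variation {f : Shift A → ℝ} (hf : totalVariation f ≠ ⊤) :
    Summable fun j => (variation f (j + 1)).toReal :=
  ENNReal.summable_toReal hf

theorem summable_variation_add {f : Shift A → ℝ} (hf : totalVariation f ≠ ⊤) (m : ℕ) :
    Summable fun k => (variation f (k + m + 1)).toReal :=
  (summable_variation hf).comp_injective (add_left_injective m)

/-- `∑_{j > m} V_j(f)`. -/
noncomputable def tailVariation (f : Shift A → ℝ) (m : ℕ) : ℝ :=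
  ∑' k, (variation f (k + m + 1)).toReal

theorem tailVariation_zero {f : Shift A → ℝ} (hf : totalVariation f ≠ ⊤) :
    tailVariation f 0 = (totalVariation f).toReal :=
  (ENNReal.tsum_toReal_eq (fun j => ENNReal.ne_top_of_tsum_ne_top hf j)).symm

theorem tendsto_tailVariation (f : Shift A → ℝ) :
    Tendsto (tailVariation f) atTop (𝓝 0) :=
  tendsto_sum_nat_add fun j => (variation f (j + 1)).toReal

/-- The `k`-th iterates still share `n + m - k` coordinates, so their values differ by at most
`V_{n+m-k}(f)`. Read backwards, these are distinct terms of the tail beyond `m`; the bound does not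
depend on `n`. -/
theorem birkhoffSum_sub_le {f : Shift A → ℝ} (hf : totalVariation f ≠ ⊤) (b : ℝ) {n m : ℕ}
    {x y : Shift A} (h : ∀ i < n + m, x.1 i = y.1 i) :
    birkhoffSum (shiftMap A) (fun x => f x - b) n x -
      birkhoffSum (shiftMap A) (fun x => f x - b) n y ≤ tailVariation f m := by
  have hs := summable_variation_add hf m
  calc _ = ∑ k ∈ Finset.range n, (f ((shiftMap A)^[k] x) - f ((shiftMap A)^[k] y)) := by
        simp only [birkhoffSum, ← Finset.sum_sub_distrib]
        exact Finset.sum_congr rfl fun k _ => by ring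
    _ ≤ ∑ k ∈ Finset.range n, (variation f (n - 1 - k + m + 1)).toReal := by
        refine Finset.sum_le_sum fun k hk => sub_le_variation hf fun i hi => ?_
        rw [Finset.mem_range] at hk
        rw [iterate_shiftMap_apply, iterate_shiftMap_apply]
        exact h _ (by omega)
    _ = ∑ k ∈ Finset.range n, (variation f (k + m + 1)).toReal :=
        Finset.sum_range_reflect (fun k => (variation f (k + m + 1)).toReal) n
    _ ≤ tailVariation f m := by
        rw [tailVariation]
        exact hs.sum_le_tsum _ fun _ _ => ENNReal.toReal_nonneg

theorem birkhoffSum_sub_le_totalVariation {f : Shift A → ℝ} (hf : totalVariation f ≠ ⊤) (b : ℝ)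
    {n : ℕ} {x y : Shift A} (h : ∀ i < n, x.1 i = y.1 i) :
    birkhoffSum (shiftMap A) (fun x => f x - b) n x -
      birkhoffSum (shiftMap A) (fun x => f x - b) n y ≤ (totalVariation f).toReal := by
  rw [← tailVariation_zero hf]
  exact birkhoffSum_sub_le hf b (m := 0) h

theorem sub_le_totalVariation {f : Shift A → ℝ} (hf : totalVariation f ≠ ⊤)
    {x y : Shift A} (h : x.1 0 = y.1 0) : f x - f y ≤ (totalVariation f).toReal := by
  have := birkhoffSum_sub_le_totalVariation hf 0 (n := 1) (x := x) (y := y)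
    (fun i hi => by obtain rfl : i = 0 := by omega
                    exact h)
  simpa using this

/-- A function whose oscillation over the cylinders of length `m + 1` is at most `∑_{j > m} V_j(f)`
is continuous. -/
theorem continuous_of_sub_le_tailVariation (f : Shift A → ℝ) {g : Shift A → ℝ}
    (hg : ∀ m x y, (∀ i < m + 1, x.1 i = y.1 i) → g x - g y ≤ tailVariation f m) :
    Continuous g := by
  rw [continuous_iff_continuousAt]
  intro x
  rw [ContinuousAt, Metric.tendsto_nhds]
  intro e he
  obtain ⟨m, hm⟩ := ((tendsto_tailVariation f).eventually (gt_mem_nhds he)).exists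
  have hc : ∀ i < m + 1, ∀ᶠ y : Shift A in 𝓝 x, y.1 i = x.1 i := fun i _ =>
    (((continuous_apply i).comp continuous_subtype_val).tendsto x).eventually
      ((isOpen_discrete {x.1 i}).mem_nhds rfl)
  have hc' : ∀ᶠ y : Shift A in 𝓝 x, ∀ i ∈ Finset.range (m + 1), y.1 i = x.1 i :=
    (Finset.eventually_all _).2 fun i hi => hc i (Finset.mem_range.1 hi)
  filter_upwards [hc'] with y hy
  have hy' : ∀ i < m + 1, y.1 i = x.1 i := fun i hi => hy i (Finset.mem_range.2 hi)
  have h1 := hg m y x hy'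
  have h2 := hg m x y fun i hi => (hy' i hi).symm
  rw [Real.dist_eq, abs_lt]
  constructor <;> linarith

theorem continuous_of_totalVariation_ne_top {f : Shift A → ℝ} (hf : totalVariation f ≠ ⊤) :
    Continuous f := by
  refine continuous_of_sub_le_tailVariation f fun m x y h => (sub_le_variation hf h).trans ?_
  have hs := summable_variation_add hf m
  have h0 := hs.le_tsum 0 fun _ _ => ENNReal.toReal_nonneg
  rwa [zero_add] at h0

theorem exists_abs_le_of_finset {f : Shift A → ℝ} (hf : totalVariation f ≠ ⊤) (F : Finset ℕ) :
    ∃ B : ℝ, ∀ x : Shift A, x.1 0 ∈ F → |f x| ≤ B := by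
  have h1 : ∀ i, ∃ B : ℝ, 0 ≤ B ∧ ∀ x : Shift A, x.1 0 = i → |f x| ≤ B := by
    intro i
    by_cases h : ∃ y : Shift A, y.1 0 = i
    · obtain ⟨y, hy⟩ := h
      refine ⟨|f y| + (totalVariation f).toReal,
        add_nonneg (abs_nonneg _) ENNReal.toReal_nonneg, fun x hx => ?_⟩
      have h1 := sub_le_totalVariation hf (hx.trans hy.symm)
      have h2 := sub_le_totalVariation hf (hy.trans hx.symm)
      rw [abs_le]
      constructor <;> linarith [le_abs_self (f y), neg_abs_le (f y)]
    · exact ⟨0, le_rfl, fun x hx => (h ⟨x, hx⟩).elim⟩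
  choose B hB0 hB using h1
  exact ⟨∑ i ∈ F, B i, fun x hx => (hB _ x rfl).trans
    (Finset.single_le_sum (fun i _ => hB0 i) hx)⟩

theorem minOn_le {f : Shift A → ℝ} (hf : totalVariation f ≠ ⊤) {S : Finset ℕ} {x : Shift A}
    (hx : x ∈ subshift A (S : Set ℕ)) : minOn f (S : Set ℕ) ≤ f x := by
  obtain ⟨B, hB⟩ := exists_abs_le_of_finset hf S
  refine csInf_le ⟨-B, ?_⟩ ⟨x, hx, rfl⟩
  rintro _ ⟨y, hy, rfl⟩
  exact (abs_le.1 (hB y (hy 0))).1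

theorem lt_of_cylinderSup_lt {f : Shift A → ℝ} {j : ℕ} {c : ℝ}
    (h : cylinderSup f j < (c : EReal)) {x : Shift A} (hx : x.1 0 = j) : f x < c := by
  have h1 : (f x : EReal) ≤ cylinderSup f j := le_iSup_of_le x (le_iSup_of_le hx le_rfl)
  exact EReal.coe_lt_coe_iff.1 (h1.trans_lt h)

/-! ### Alphabets completed by connecting words -/

theorem mem_completedAlphabet_of_lt {w : ℕ → ℕ → List ℕ} {I i : ℕ} (hi : i < I) :
    i ∈ completedAlphabet w I :=
  Finset.mem_union_left _ (Finset.mem_range.2 hi)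

theorem mem_completedAlphabet_of_mem {w : ℕ → ℕ → List ℕ} {I i j s : ℕ} (hi : i < I) (hj : j < I)
    (hs : s ∈ w i j) : s ∈ completedAlphabet w I := by
  refine Finset.mem_union_right _ (Finset.mem_biUnion.2 ⟨(i, j), ?_, List.mem_toFinset.2 hs⟩)
  simp [hi, hj]

theorem mem_completedAlphabet {w : ℕ → ℕ → List ℕ} {I s : ℕ} (hs : s ∈ completedAlphabet w I) :
    s < I ∨ ∃ i < I, ∃ j < I, s ∈ w i j := by
  simp only [completedAlphabet, Finset.mem_union, Finset.mem_range, Finset.mem_biUnion,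
    Finset.mem_product, List.mem_toFinset, Prod.exists] at hs
  rcases hs with hs | ⟨i, j, ⟨hi, hj⟩, hs⟩
  · exact Or.inl hs
  · exact Or.inr ⟨i, hi, j, hj, hs⟩

theorem length_le_maxWordLength {w : ℕ → ℕ → List ℕ} {I i j : ℕ} (hi : i < I) (hj : j < I) :
    (w i j).length ≤ maxWordLength w I :=
  Finset.le_sup (f := fun p : ℕ × ℕ => (w p.1 p.2).length) (b := (i, j)) (by simp [hi, hj])

/-- A symbol inside a word `w i j` reaches `j` along the rest of the word and is reached from `i`
along its beginning. Both endpoints are below `I`, where the chosen words connect everything. -/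
theorem irreducibleOn_completedAlphabet {w : ℕ → ℕ → List ℕ} {I : ℕ}
    (hw : ∀ i < I, ∀ j < I, Connects A i (w i j) j) :
    IrreducibleOn A (completedAlphabet w I : Set ℕ) := by
  have htrans : ∀ {a b c : ℕ}, b ∈ completedAlphabet w I →
      (∃ u : List ℕ, (∀ s ∈ u, s ∈ completedAlphabet w I) ∧ Connects A a u b) →
      (∃ u : List ℕ, (∀ s ∈ u, s ∈ completedAlphabet w I) ∧ Connects A b u c) →
      ∃ u : List ℕ, (∀ s ∈ u, s ∈ completedAlphabet w I) ∧ Connects A a u c := by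
    rintro a b c hb ⟨u, hu, hu'⟩ ⟨v, hv, hv'⟩
    refine ⟨u ++ b :: v, ?_, connects_append_cons.2 ⟨hu', hv'⟩⟩
    intro s hs
    simp only [List.mem_append, List.mem_cons] at hs
    rcases hs with hs | rfl | hs
    exacts [hu s hs, hb, hv s hs]
  have hbase : ∀ i < I, ∀ j < I,
      ∃ u : List ℕ, (∀ s ∈ u, s ∈ completedAlphabet w I) ∧ Connects A i u j := fun i hi j hj =>
    ⟨w i j, fun s hs => mem_completedAlphabet_of_mem hi hj hs, hw i hi j hj⟩
  have hout : ∀ a ∈ completedAlphabet w I, ∃ i < I,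
      ∃ u : List ℕ, (∀ s ∈ u, s ∈ completedAlphabet w I) ∧ Connects A a u i := by
    intro a ha
    rcases mem_completedAlphabet ha with ha | ⟨i, hi, j, hj, hs⟩
    · exact ⟨a, ha, hbase a ha a ha⟩
    · obtain ⟨l, r, hlr⟩ := List.append_of_mem hs
      have h := hw i hi j hj
      rw [hlr] at h
      exact ⟨j, hj, r, fun s hs => mem_completedAlphabet_of_mem hi hj (by rw [hlr]; simp [hs]),
        (connects_append_cons.1 h).2⟩
  have hin : ∀ a ∈ completedAlphabet w I, ∃ i < I,
      ∃ u : List ℕ, (∀ s ∈ u, s ∈ completedAlphabet w I) ∧ Connects A i u a := by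
    intro a ha
    rcases mem_completedAlphabet ha with ha | ⟨i, hi, j, hj, hs⟩
    · exact ⟨a, ha, hbase a ha a ha⟩
    · obtain ⟨l, r, hlr⟩ := List.append_of_mem hs
      have h := hw i hi j hj
      rw [hlr] at h
      exact ⟨i, hi, l, fun s hs => mem_completedAlphabet_of_mem hi hj (by rw [hlr]; simp [hs]),
        (connects_append_cons.1 h).1⟩
  intro a ha b hb
  obtain ⟨i, hi, hai⟩ := hout a ha
  obtain ⟨j, hj, hjb⟩ := hin b hb
  exact htrans (mem_completedAlphabet_of_lt hj)
    (htrans (mem_completedAlphabet_of_lt hi) hai (hbase i hi j hj)) hjb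

/-- A point of the subshift on the completed alphabet that begins with `i w(i,j) j`. -/
theorem exists_mem_subshift_completedAlphabet (hA : IrreducibleOn A Set.univ)
    {w : ℕ → ℕ → List ℕ} {I : ℕ} (hw : ∀ i < I, ∀ j < I, Connects A i (w i j) j)
    {i j : ℕ} (hi : i < I) (hj : j < I) :
    ∃ u ∈ subshift A (completedAlphabet w I : Set ℕ),
      u.1 0 = i ∧ u.1 ((w i j).length + 1) = j := by
  have hword : ∀ {a b : ℕ} (_ : a < I) (_ : b < I) {z : Shift A} (_ : z.1 0 = b),
      ∃ u : Shift A, u.1 0 = a ∧ (∀ k < (w a b).length + 1, u.1 k ∈ completedAlphabet w I) ∧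
        (shiftMap A)^[(w a b).length + 1] u = z := by
    intro a b ha hb z hz
    obtain ⟨u, hu0, hum, huz⟩ := exists_point_of_connects (hw a ha b hb) hz
    refine ⟨u, hu0, fun k hk => ?_, huz⟩
    cases k with
    | zero => rw [hu0]; exact mem_completedAlphabet_of_lt ha
    | succ k => exact mem_completedAlphabet_of_mem ha hb (hum k (by omega))
  -- The point `z₀` may leave the alphabet and only serves to realize the word `w j j` inside a
  -- point. Repeating the loop `j w(j,j)` periodically then gives a tail that stays in the alphabet.
  obtain ⟨z₀, hz₀⟩ := exists_point_start hA j
  obtain ⟨u₁, hu₁0, hu₁m, hu₁z⟩ := hword hj hj hz₀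
  have hcyc : u₁.1 ((w j j).length + 1) = u₁.1 0 := by
    have := iterate_shiftMap_apply u₁ ((w j j).length + 1) 0
    rw [hu₁z, hz₀, Nat.add_zero] at this
    exact this.symm.trans hu₁0.symm
  obtain ⟨u, hu0, hum, huz⟩ :=
    hword hi hj (z := cyclePoint u₁ ((w j j).length + 1) (Nat.succ_pos _) hcyc) (by
      simp [cyclePoint_apply, hu₁0])
  have hadd : ∀ k, u.1 ((w i j).length + 1 + k) = u₁.1 (k % ((w j j).length + 1)) := by
    intro k
    rw [← iterate_shiftMap_apply, huz, cyclePoint_apply]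
  refine ⟨u, fun k => ?_, hu0, ?_⟩
  · rcases lt_or_ge k ((w i j).length + 1) with hk | hk
    · exact hum k hk
    · obtain ⟨l, rfl⟩ := Nat.exists_eq_add_of_le hk
      rw [hadd]
      exact hu₁m _ (Nat.mod_lt _ (Nat.succ_pos _))
  · simpa [hu₁0] using hadd 0

/-! ### Replacing an excursion by a connecting word -/

/-- The standing assumptions on `f`: it has bounded variation, the chosen words connect the symbols
below `I₁`, and `f` is small on the cylinders of large symbols. -/
structure ExcursionBounds (A : ℕ → ℕ → Fin 2) (f : Shift A → ℝ) (β ε : ℝ) (I₁ I₂ : ℕ)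
    (w : ℕ → ℕ → List ℕ) : Prop where
  irreducible : IrreducibleOn A Set.univ
  totalVariation_ne_top : totalVariation f ≠ ⊤
  eps_pos : 0 < ε
  pos : 0 < I₁
  connects : ∀ i < I₁, ∀ j < I₁, Connects A i (w i j) j
  lt_of_ge : ∀ x : Shift A, I₁ ≤ x.1 0 → f x < β - ε
  lt_constC : ∀ x : Shift A, I₂ ≤ x.1 0 → f x < constC f β ε w I₁

/-- This is the inequality for which `C` is designed, `p` being the length of the inserted word. One
`V(f)` pays for changing the future of the common prefix, the other for comparing the word with a
point of `Σ_A(𝒜₁)`. An empty word needs only the first, and `C₂` suffices; otherwise `C₁` is used.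
-/
theorem constC_sub_le {f : Shift A → ℝ} {β ε b : ℝ} {I₁ : ℕ} {w : ℕ → ℕ → List ℕ}
    (hb₁ : β - ε ≤ b) (hb₂ : b ≤ β) {p : ℕ} (hp : p ≤ maxWordLength w I₁) :
    constC f β ε w I₁ - b + (totalVariation f).toReal ≤
      if p = 0 then 0 else
        (p : ℝ) * (minOn f (completedAlphabet w I₁ : Set ℕ) - b) - (totalVariation f).toReal := by
  split_ifs with h0
  · have : constC f β ε w I₁ ≤ constC₂ f β ε := min_le_right _ _
    rw [constC₂] at this
    linarith
  · have : constC f β ε w I₁ ≤ constC₁ f β w I₁ := min_le_left _ _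
    rw [constC₁] at this
    set P : ℝ := (maxWordLength w I₁ : ℝ)
    set μ := minOn f (completedAlphabet w I₁ : Set ℕ)
    have hp1 : (1 : ℝ) ≤ p := by exact_mod_cast Nat.one_le_iff_ne_zero.2 h0
    have hpP : (p : ℝ) ≤ P := Nat.cast_le.2 hp
    have h1 : -(P * |μ|) ≤ p * μ := by
      have := mul_le_mul_of_nonneg_right hpP (abs_nonneg μ)
      have := mul_le_mul_of_nonneg_left (neg_abs_le μ) (by linarith : (0 : ℝ) ≤ p)
      linarith
    have h2 : ((p : ℝ) - 1) * b ≤ (P - 1) * |β| :=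
      calc ((p : ℝ) - 1) * b ≤ (p - 1) * |β| :=
            mul_le_mul_of_nonneg_left (hb₂.trans (le_abs_self β)) (by linarith)
        _ ≤ (P - 1) * |β| := mul_le_mul_of_nonneg_right (by linarith) (abs_nonneg β)
    linarith

theorem mul_le_birkhoffSum {g : Shift A → ℝ} {c : ℝ} {n : ℕ} {x : Shift A}
    (h : ∀ k < n, c ≤ g ((shiftMap A)^[k] x)) : (n : ℝ) * c ≤ birkhoffSum (shiftMap A) g n x := by
  have := Finset.card_nsmul_le_sum (Finset.range n) (fun k => g ((shiftMap A)^[k] x)) c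
    (fun k hk => h k (Finset.mem_range.1 hk))
  simpa [birkhoffSum] using this

theorem birkhoffSum_le_mul {g : Shift A → ℝ} {c : ℝ} {n : ℕ} {x : Shift A}
    (h : ∀ k < n, g ((shiftMap A)^[k] x) ≤ c) : birkhoffSum (shiftMap A) g n x ≤ (n : ℝ) * c := by
  have := Finset.sum_le_card_nsmul (Finset.range n) (fun k => g ((shiftMap A)^[k] x)) c
    (fun k hk => h k (Finset.mem_range.1 hk))
  simpa [birkhoffSum] using this

/-- An excursion `y_{s+1} … y_{s+m}` above `I₁` with a symbol `y_k ≥ I₂` can be replaced by a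
connecting word; the Birkhoff sum increases by at least `C - f (σ^k y) > 0`. -/
theorem ExcursionBounds.exists_replacement {f : Shift A → ℝ} {β ε : ℝ} {I₁ I₂ : ℕ}
    {w : ℕ → ℕ → List ℕ} (H : ExcursionBounds A f β ε I₁ I₂ w) {b : ℝ}
    (hb₁ : β - ε ≤ b) (hb₂ : b ≤ β) {y : Shift A} {s m k : ℕ} (hs : y.1 s < I₁)
    (ht : y.1 (s + 1 + m) < I₁) (hexc : ∀ i, s < i → i < s + 1 + m → I₁ ≤ y.1 i)
    (hk₁ : s < k) (hk₂ : k < s + 1 + m) :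
    ∃ (y' : Shift A) (p : ℕ),
      (shiftMap A)^[s + 1 + p] y' = (shiftMap A)^[s + 1 + m] y ∧
      (∀ i ≤ s, y'.1 i = y.1 i) ∧
      (∀ i, s < i → i < s + 1 + p → y'.1 i ∈ completedAlphabet w I₁) ∧
      birkhoffSum (shiftMap A) (fun x => f x - b) (s + 1 + m) y +
          (constC f β ε w I₁ - f ((shiftMap A)^[k] y)) ≤
        birkhoffSum (shiftMap A) (fun x => f x - b) (s + 1 + p) y' := by
  have hf := H.totalVariation_ne_top
  obtain ⟨u, huS, hu0, hut⟩ :=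
    exists_mem_subshift_completedAlphabet H.irreducible H.connects hs ht
  set p := (w (y.1 s) (y.1 (s + 1 + m))).length with hp
  have hpP : p ≤ maxWordLength w I₁ := length_le_maxWordLength hs ht
  set z := (shiftMap A)^[s + 1 + m] y with hz
  have hz0 : z.1 0 = y.1 (s + 1 + m) := iterate_shiftMap_apply _ _ _
  let q : Shift A := splice u (p + 1) z (by rw [hut, hz0])
  have hqu : ∀ i ≤ p + 1, q.1 i = u.1 i := fun i hi => splice_apply_of_le _ hi
  have hqz : (shiftMap A)^[p + 1] q = z := iterate_splice _
  have hyq : y.1 s = q.1 0 := by rw [hqu 0 (Nat.zero_le _), hu0]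
  let y' : Shift A := splice y s q hyq
  have hy'y : ∀ i ≤ s, y'.1 i = y.1 i := fun i hi => splice_apply_of_le _ hi
  have hy'q : (shiftMap A)^[s] y' = q := iterate_splice _
  have hy'1 : (shiftMap A)^[s + 1] y' = shiftMap A q := by
    rw [Function.iterate_succ_apply', hy'q]
  refine ⟨y', p, ?_, hy'y, ?_, ?_⟩
  · rw [show s + 1 + p = (p + 1) + s by omega, Function.iterate_add_apply, hy'q, hqz]
  · intro i hi₁ hi₂
    obtain ⟨l, rfl⟩ := Nat.exists_eq_add_of_lt hi₁
    rw [add_assoc]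
    change (splice y s q hyq).1 _ ∈ _
    rw [splice_apply_add, hqu _ (by omega)]
    exact huS _
  · set V := (totalVariation f).toReal
    set h : Shift A → ℝ := fun x => f x - b
    have e1 : birkhoffSum (shiftMap A) h (s + 1) y - birkhoffSum (shiftMap A) h (s + 1) y' ≤ V :=
      birkhoffSum_sub_le_totalVariation hf b fun i hi => (hy'y i (by omega)).symm
    -- Every term of the excursion is nonpositive, so the sum is at most its `k`-th term alone.
    have e2 : birkhoffSum (shiftMap A) h m ((shiftMap A)^[s + 1] y) ≤
        f ((shiftMap A)^[k] y) - b := by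
      obtain ⟨l, rfl⟩ := Nat.exists_eq_add_of_lt hk₁
      have hle : ∀ i ∈ Finset.range m, 0 ≤ -h ((shiftMap A)^[i] ((shiftMap A)^[s + 1] y)) := by
        intro i hi
        rw [Finset.mem_range] at hi
        rw [← Function.iterate_add_apply]
        have := H.lt_of_ge ((shiftMap A)^[i + (s + 1)] y) (by
          rw [iterate_shiftMap_apply]; exact hexc _ (by omega) (by omega))
        simp only [h]
        linarith
      have := Finset.single_le_sum hle (Finset.mem_range.2 (show l < m by omega))
      rw [Finset.sum_neg_distrib, ← Function.iterate_add_apply] at this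
      rw [show s + l + 1 = l + (s + 1) by omega]
      simp only [birkhoffSum]
      simp only [h] at this ⊢
      linarith
    have e3 : (if p = 0 then 0 else
        (p : ℝ) * (minOn f (completedAlphabet w I₁ : Set ℕ) - b) - V) ≤
          birkhoffSum (shiftMap A) h p ((shiftMap A)^[s + 1] y') := by
      split_ifs with h0
      · simp [h0]
      · rw [hy'1]
        have e4 : birkhoffSum (shiftMap A) h p (shiftMap A u) -
            birkhoffSum (shiftMap A) h p (shiftMap A q) ≤ V :=
          birkhoffSum_sub_le_totalVariation hf b fun i hi => (hqu (i + 1) (by omega)).symm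
        have e5 : (p : ℝ) * (minOn f (completedAlphabet w I₁ : Set ℕ) - b) ≤
            birkhoffSum (shiftMap A) h p (shiftMap A u) := by
          refine mul_le_birkhoffSum fun i _ => sub_le_sub_right (minOn_le hf fun l => ?_) _
          rw [← Function.iterate_succ_apply, iterate_shiftMap_apply]
          exact huS _
        linarith
    have e6 := constC_sub_le (f := f) hb₁ hb₂ hpP
    rw [birkhoffSum_add _ _ (s + 1), birkhoffSum_add _ _ (s + 1)]
    linarith

/-! ### The sub-action -/

theorem exists_last_lt {a : ℕ → ℕ} {I n : ℕ} (h0 : a 0 < I) (hn : 0 < n) :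
    ∃ s < n, a s < I ∧ ∀ i, s < i → i < n → I ≤ a i := by
  refine ⟨Nat.findGreatest (fun i => a i < I) (n - 1), ?_, ?_, ?_⟩
  · have := Nat.findGreatest_le (P := fun i => a i < I) (n - 1)
    omega
  · exact Nat.findGreatest_spec (P := fun i => a i < I) (Nat.zero_le (n - 1)) h0
  · intro i hi₁ hi₂
    exact not_lt.1 (Nat.findGreatest_is_greatest (P := fun i => a i < I) hi₁ (by omega))

/-- Induction on the length: cut at the last earlier visit below `I₁`, correct the path up to there,
then keep or bypass the final excursion. The tail is preserved but the length may change. -/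
theorem ExcursionBounds.exists_path_mem
    {f : Shift A → ℝ} {β ε : ℝ} {I₁ I₂ : ℕ} {w : ℕ → ℕ → List ℕ}
    (H : ExcursionBounds A f β ε I₁ I₂ w) {b : ℝ} (hb₁ : β - ε ≤ b) (hb₂ : b ≤ β) {S : Finset ℕ}
    (hS₁ : completedAlphabet w I₁ ⊆ S) (hS₂ : Finset.range I₂ ⊆ S)
    (n : ℕ) (y : Shift A) (h0 : y.1 0 < I₁)
    (hn : y.1 n < I₁) :
    ∃ (y' : Shift A) (n' : ℕ), (shiftMap A)^[n'] y' = (shiftMap A)^[n] y ∧ y'.1 0 = y.1 0 ∧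
      (∀ i < n', y'.1 i ∈ S) ∧
      birkhoffSum (shiftMap A) (fun x => f x - b) n y ≤
        birkhoffSum (shiftMap A) (fun x => f x - b) n' y' := by
  induction n using Nat.strong_induction_on with
  | _ n ih =>
    rcases Nat.eq_zero_or_pos n with rfl | hpos
    · exact ⟨y, 0, rfl, rfl, by simp, le_rfl⟩
    obtain ⟨s, hsn, hs, hexc⟩ := exists_last_lt h0 hpos
    obtain ⟨y₁, n₁, hy₁, hy₁0, hy₁S, hy₁le⟩ := ih s hsn hs
    obtain ⟨m, rfl⟩ := Nat.exists_eq_add_of_lt hsn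
    have hsym : ∀ i, y₁.1 (n₁ + i) = y.1 (s + i) := fun i => by
      rw [← iterate_shiftMap_apply, hy₁, iterate_shiftMap_apply]
    have hend : (shiftMap A)^[n₁ + 1 + m] y₁ = (shiftMap A)^[s + m + 1] y := by
      rw [show n₁ + 1 + m = (m + 1) + n₁ by omega, show s + m + 1 = (m + 1) + s by omega,
        Function.iterate_add_apply _ _ n₁, Function.iterate_add_apply _ _ s, hy₁]
    have hsum : birkhoffSum (shiftMap A) (fun x => f x - b) (s + m + 1) y ≤
        birkhoffSum (shiftMap A) (fun x => f x - b) (n₁ + 1 + m) y₁ := by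
      rw [show n₁ + 1 + m = n₁ + (m + 1) by omega, show s + m + 1 = s + (m + 1) by omega,
        birkhoffSum_add _ _ n₁, birkhoffSum_add _ _ s, hy₁]
      linarith
    have hsn₁ : y₁.1 n₁ = y.1 s := hsym 0
    -- An excursion leaving `S` contains a symbol `≥ I₂`, so bypassing it increases the sum.
    by_cases hall : ∀ i, n₁ < i → i < n₁ + 1 + m → y₁.1 i ∈ S
    · refine ⟨y₁, n₁ + 1 + m, hend, hy₁0, fun i hi => ?_, hsum⟩
      rcases lt_trichotomy i n₁ with h | rfl | h
      · exact hy₁S i h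
      · rw [hsn₁]
        exact hS₁ (mem_completedAlphabet_of_lt hs)
      · exact hall i h hi
    · push Not at hall
      obtain ⟨k, hk₁, hk₂, hkS⟩ := hall
      have hkI : I₂ ≤ y₁.1 k := by
        by_contra hlt
        exact hkS (hS₂ (Finset.mem_range.2 (not_le.1 hlt)))
      obtain ⟨y₂, p, hy₂, hy₂y, hy₂S, hy₂le⟩ := H.exists_replacement hb₁ hb₂ (y := y₁) (s := n₁)
        (m := m) (k := k) (by rw [hsn₁]; exact hs)
        (by rw [show n₁ + 1 + m = n₁ + (m + 1) by omega, hsym]; exact hn)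
        (fun i hi₁ hi₂ => by
          obtain ⟨l, rfl⟩ := Nat.exists_eq_add_of_lt hi₁
          rw [add_assoc, hsym]
          exact hexc _ (by omega) (by omega)) hk₁ hk₂
      have hgap := H.lt_constC ((shiftMap A)^[k] y₁) (by rw [iterate_shiftMap_apply]; exact hkI)
      refine ⟨y₂, n₁ + 1 + p, hy₂.trans hend, (hy₂y 0 (Nat.zero_le _)).trans hy₁0, fun i hi => ?_,
        by linarith⟩
      rcases lt_trichotomy i n₁ with h | rfl | h
      · rw [hy₂y i h.le]
        exact hy₁S i h
      · rw [hy₂y i le_rfl, hsn₁]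
        exact hS₁ (mem_completedAlphabet_of_lt hs)
      · exact hS₁ (hy₂S i h hi)

theorem ExcursionBounds.exists_birkhoffSum_le_of_lt
    {f : Shift A → ℝ} {β ε : ℝ} {I₁ I₂ : ℕ} {w : ℕ → ℕ → List ℕ}
    (H : ExcursionBounds A f β ε I₁ I₂ w) {b : ℝ} (hb₁ : β - ε ≤ b) (hb₂ : b ≤ β) {S : Finset ℕ}
    (hS₁ : completedAlphabet w I₁ ⊆ S) (hS₂ : Finset.range I₂ ⊆ S)
    (hper : ∀ x ∈ subshift A (S : Set ℕ), ∀ N, 0 < N → (shiftMap A)^[N] x = x →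
      birkhoffSum (shiftMap A) (fun x => f x - b) N x ≤ 0) :
    ∃ K : ℝ, ∀ (y : Shift A) (n : ℕ), y.1 0 = 0 → y.1 n < I₁ →
      birkhoffSum (shiftMap A) (fun x => f x - b) n y ≤ K := by
  have hf := H.totalVariation_ne_top
  obtain ⟨B, hB⟩ := exists_abs_le_of_finset hf S
  -- The corrected path is closed by a word back to `0` into a periodic orbit in `Σ_A(S)`, of
  -- nonpositive sum. Periodizing costs `V(f)`; the closing stretch has at most `P₀ + 1` terms, each
  -- at least `-B - b`.
  refine ⟨(totalVariation f).toReal + ((maxWordLength w I₁ : ℝ) + 1) * |B + b|,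
    fun y n hy0 hyn => ?_⟩
  obtain ⟨y₁, n₁, hy₁, hy₁0, hy₁S, hle⟩ :=
    H.exists_path_mem hb₁ hb₂ hS₁ hS₂ n y (by rw [hy0]; exact H.pos) hyn
  refine hle.trans ?_
  have hend : y₁.1 n₁ = y.1 n := by
    have h1 := iterate_shiftMap_apply y₁ n₁ 0
    have h2 := iterate_shiftMap_apply y n 0
    rw [hy₁] at h1
    exact h1.symm.trans h2
  obtain ⟨u, huS, hu0, hu1⟩ :=
    exists_mem_subshift_completedAlphabet H.irreducible H.connects (hend ▸ hyn) H.pos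
  set p := (w (y₁.1 n₁) 0).length with hp
  have hpP : p ≤ maxWordLength w I₁ := length_le_maxWordLength (hend ▸ hyn) H.pos
  let y₂ : Shift A := splice y₁ n₁ u hu0.symm
  have hy₂ : ∀ i ≤ n₁, y₂.1 i = y₁.1 i := fun i hi => splice_apply_of_le _ hi
  have hcl : y₂.1 (n₁ + (p + 1)) = y₂.1 0 :=
    (splice_apply_add _ _).trans (hu1.trans ((hy₂ 0 (Nat.zero_le _)).trans (hy₁0.trans hy0)).symm)
  let c : Shift A := cyclePoint y₂ (n₁ + (p + 1)) (by omega) hcl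
  have hcS : c ∈ subshift A (S : Set ℕ) := by
    intro i
    change y₂.1 (i % (n₁ + (p + 1))) ∈ (S : Set ℕ)
    rcases lt_or_ge (i % (n₁ + (p + 1))) n₁ with h | h
    · rw [hy₂ _ h.le]
      exact hy₁S _ h
    · obtain ⟨l, hl⟩ := Nat.exists_eq_add_of_le h
      rw [hl]
      exact (splice_apply_add hu0.symm l).symm ▸ hS₁ (huS l)
  have e1 := hper c hcS (n₁ + (p + 1)) (by omega) (iterate_cyclePoint _ hcl)
  have e2 : birkhoffSum (shiftMap A) (fun x => f x - b) n₁ y₁ -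
      birkhoffSum (shiftMap A) (fun x => f x - b) n₁ c ≤ (totalVariation f).toReal :=
    birkhoffSum_sub_le_totalVariation hf b fun i hi => by
      rw [← hy₂ i hi.le]
      change _ = y₂.1 (i % (n₁ + (p + 1)))
      rw [Nat.mod_eq_of_lt (by omega)]
  have e3 : ((p + 1 : ℕ) : ℝ) * (-B - b) ≤
      birkhoffSum (shiftMap A) (fun x => f x - b) (p + 1) ((shiftMap A)^[n₁] c) := by
    refine mul_le_birkhoffSum fun k _ => sub_le_sub_right ?_ _
    refine (abs_le.1 (hB _ ?_)).1
    rw [← Function.iterate_add_apply, iterate_shiftMap_apply]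
    exact hcS _
  have e4 : ((p + 1 : ℕ) : ℝ) * (B + b) ≤ ((maxWordLength w I₁ : ℝ) + 1) * |B + b| :=
    (mul_le_mul_of_nonneg_left (le_abs_self _) (Nat.cast_nonneg _)).trans
      (mul_le_mul_of_nonneg_right (by exact_mod_cast Nat.succ_le_succ hpP) (abs_nonneg _))
  rw [birkhoffSum_add] at e1
  linarith

/-- After the last visit below `I₁` all terms are negative, and the visit itself contributes at most
`B - b`. -/
theorem ExcursionBounds.exists_birkhoffSum_le
    {f : Shift A → ℝ} {β ε : ℝ} {I₁ I₂ : ℕ} {w : ℕ → ℕ → List ℕ}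
    (H : ExcursionBounds A f β ε I₁ I₂ w) {b : ℝ} (hb₁ : β - ε ≤ b) (hb₂ : b ≤ β) {S : Finset ℕ}
    (hS₁ : completedAlphabet w I₁ ⊆ S) (hS₂ : Finset.range I₂ ⊆ S)
    (hper : ∀ x ∈ subshift A (S : Set ℕ), ∀ N, 0 < N → (shiftMap A)^[N] x = x →
      birkhoffSum (shiftMap A) (fun x => f x - b) N x ≤ 0) :
    ∃ K : ℝ, ∀ (y : Shift A) (n : ℕ), y.1 0 = 0 → 0 < n →
      birkhoffSum (shiftMap A) (fun x => f x - b) n y ≤ K := by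
  obtain ⟨K, hK⟩ := H.exists_birkhoffSum_le_of_lt hb₁ hb₂ hS₁ hS₂ hper
  obtain ⟨B, hB⟩ := exists_abs_le_of_finset H.totalVariation_ne_top S
  refine ⟨K + (B - b), fun y n hy0 hn => ?_⟩
  obtain ⟨s, hsn, hs, hexc⟩ := exists_last_lt (a := y.1) (I := I₁) (by rw [hy0]; exact H.pos) hn
  obtain ⟨m, rfl⟩ := Nat.exists_eq_add_of_lt hsn
  have e1 := hK y s hy0 hs
  have e2 : f ((shiftMap A)^[s] y) ≤ B := by
    refine (abs_le.1 (hB _ ?_)).2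
    rw [iterate_shiftMap_apply]
    exact hS₁ (mem_completedAlphabet_of_lt hs)
  have e3 : birkhoffSum (shiftMap A) (fun x => f x - b) m ((shiftMap A)^[s + 1] y) ≤ m * 0 := by
    refine birkhoffSum_le_mul fun k hk => ?_
    have := H.lt_of_ge ((shiftMap A)^[k] ((shiftMap A)^[s + 1] y)) (by
      rw [← Function.iterate_add_apply, iterate_shiftMap_apply]
      exact hexc _ (by omega) (by omega))
    linarith
  rw [show s + m + 1 = s + 1 + m by omega, birkhoffSum_add, birkhoffSum_succ]
  linarith

/-- A continuous sub-action, strict along the excursions that reach a symbol `≥ I₂`. -/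
theorem ExcursionBounds.exists_subaction
    {f : Shift A → ℝ} {β ε : ℝ} {I₁ I₂ : ℕ} {w : ℕ → ℕ → List ℕ}
    (H : ExcursionBounds A f β ε I₁ I₂ w) {b : ℝ} (hb₁ : β - ε ≤ b) (hb₂ : b ≤ β) {S : Finset ℕ}
    (hS₁ : completedAlphabet w I₁ ⊆ S) (hS₂ : Finset.range I₂ ⊆ S)
    (hper : ∀ x ∈ subshift A (S : Set ℕ), ∀ N, 0 < N → (shiftMap A)^[N] x = x →
      birkhoffSum (shiftMap A) (fun x => f x - b) N x ≤ 0) :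
    ∃ φ : Shift A → ℝ, Continuous φ ∧ (∀ x, φ x + (f x - b) ≤ φ (shiftMap A x)) ∧
      (∀ x y : Shift A, x.1 0 = y.1 0 → φ x - φ y ≤ (totalVariation f).toReal) ∧
      ∀ (x : Shift A) (m k : ℕ), x.1 0 < I₁ → x.1 (1 + m) < I₁ →
        (∀ i, 0 < i → i < 1 + m → I₁ ≤ x.1 i) → 0 < k → k < 1 + m →
        φ x + birkhoffSum (shiftMap A) (fun x => f x - b) (1 + m) x +
          (constC f β ε w I₁ - f ((shiftMap A)^[k] x)) ≤ φ ((shiftMap A)^[1 + m] x) := by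
  have hf := H.totalVariation_ne_top
  let h : Shift A → ℝ := fun x => f x - b
  -- The sub-action is the supremum of `P x`, the sums along all paths from the symbol `0` to `x`.
  let P : Shift A → Set ℝ := fun x => {r | ∃ (y : Shift A) (n : ℕ), 0 < n ∧ y.1 0 = 0 ∧
    (shiftMap A)^[n] y = x ∧ birkhoffSum (shiftMap A) h n y = r}
  obtain ⟨K, hK⟩ := H.exists_birkhoffSum_le hb₁ hb₂ hS₁ hS₂ hper
  have hbdd : ∀ x, BddAbove (P x) := fun x => ⟨K, by
    rintro _ ⟨y, n, hn, hy0, -, rfl⟩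
    exact hK y n hy0 hn⟩
  have hne : ∀ x, (P x).Nonempty := fun x => by
    obtain ⟨u, -, hu⟩ := H.irreducible 0 trivial (x.1 0) trivial
    obtain ⟨y, hy0, -, hyx⟩ := exists_point_of_connects hu (z := x) rfl
    exact ⟨_, y, u.length + 1, Nat.succ_pos _, hy0, hyx, rfl⟩
  have hosc : ∀ m (x y : Shift A), (∀ i < m + 1, x.1 i = y.1 i) →
      sSup (P x) - sSup (P y) ≤ tailVariation f m := by
    intro m x x' hxx'
    rw [sub_le_iff_le_add]
    refine csSup_le (hne x) ?_
    rintro _ ⟨y, n, hn, hy0, hyx, rfl⟩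
    have hsym : ∀ i, y.1 (n + i) = x.1 i := fun i => by rw [← iterate_shiftMap_apply, hyx]
    have hj : y.1 n = x'.1 0 := (hsym 0).trans (hxx' 0 (Nat.succ_pos _))
    -- The same path can be put in front of `x'`, since `x` and `x'` begin with the same symbol.
    have h1 : birkhoffSum (shiftMap A) h n (splice y n x' hj) ≤ sSup (P x') :=
      le_csSup (hbdd x') ⟨_, n, hn, (splice_apply_of_le hj (Nat.zero_le _)).trans hy0,
        iterate_splice hj, rfl⟩
    have h2 : birkhoffSum (shiftMap A) h n y -
        birkhoffSum (shiftMap A) h n (splice y n x' hj) ≤ tailVariation f m :=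
      birkhoffSum_sub_le hf b fun i hi => by
        rcases le_or_gt i n with hin | hin
        · rw [splice_apply_of_le hj hin]
        · obtain ⟨l, rfl⟩ := Nat.exists_eq_add_of_le hin.le
          rw [splice_apply_add, hsym]
          exact hxx' l (by omega)
    linarith
  refine ⟨fun x => sSup (P x), continuous_of_sub_le_tailVariation f hosc, fun x => ?_,
    fun x y hxy => ?_, fun x m k hx hxm hexc hk₁ hk₂ => ?_⟩
  · rw [← le_sub_iff_add_le]
    refine csSup_le (hne x) ?_
    rintro _ ⟨y, n, hn, hy0, rfl, rfl⟩
    rw [le_sub_iff_add_le]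
    refine le_csSup (hbdd _) ⟨y, n + 1, Nat.succ_pos _, hy0, ?_, ?_⟩
    · rw [Function.iterate_succ_apply']
    · rw [birkhoffSum_succ]
  · rw [← tailVariation_zero hf]
    exact hosc 0 x y fun i hi => by
      obtain rfl : i = 0 := by omega
      exact hxy
  · rw [add_assoc, ← le_sub_iff_add_le]
    refine csSup_le (hne x) ?_
    rintro _ ⟨y, n, hn, hy0, hyx, rfl⟩
    have hsym : ∀ i, y.1 (n + i) = x.1 i := fun i => by rw [← iterate_shiftMap_apply, hyx]
    -- Bypassing the excursion in a path through `x` gives a better competitor for the supremum at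
    -- its end; the gain survives in the supremum.
    obtain ⟨y', p, hy', hy'y, -, hle⟩ := H.exists_replacement hb₁ hb₂ (y := y) (s := n) (m := m)
      (k := n + k) (by rw [← add_zero n, hsym]; exact hx)
      (by rw [add_assoc, hsym]; exact hxm)
      (fun i hi₁ hi₂ => by
        obtain ⟨l, rfl⟩ := Nat.exists_eq_add_of_lt hi₁
        rw [add_assoc, hsym]
        exact hexc _ (by omega) (by omega)) (by omega) (by omega)
    have h1 : birkhoffSum (shiftMap A) h (n + 1 + p) y' ≤ sSup (P ((shiftMap A)^[1 + m] x)) := by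
      refine le_csSup (hbdd _) ⟨y', n + 1 + p, by omega, (hy'y 0 (Nat.zero_le _)).trans hy0, ?_, rfl⟩
      rw [hy', ← hyx, ← Function.iterate_add_apply, show n + 1 + m = 1 + m + n by omega]
    rw [show n + k = k + n by omega, Function.iterate_add_apply, hyx, add_assoc n 1 m,
      birkhoffSum_add _ _ n, hyx] at hle
    rw [le_sub_iff_add_le]
    linarith

/-! ### Integrals against invariant measures -/

theorem continuous_shiftMap : Continuous (shiftMap A) :=
  continuous_induced_rng.2 (continuous_pi fun i =>
    (continuous_apply (i + 1)).comp continuous_subtype_val)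

theorem measurable_shiftMap : Measurable (shiftMap A) := continuous_shiftMap.measurable

theorem isClosed_subshift (S : Set ℕ) : IsClosed (subshift A S) := by
  have : subshift A S = ⋂ i, (fun x : Shift A => x.1 i) ⁻¹' S := by
    ext x
    simp [subshift]
  rw [this]
  exact isClosed_iInter fun i => (isClosed_discrete S).preimage
    ((continuous_apply i).comp continuous_subtype_val)

theorem extIntegral_eq_integral {f : Shift A → ℝ} {μ : Measure (Shift A)} (hf : Integrable f μ) :
    extIntegral f μ = ((∫ x, f x ∂μ : ℝ) : EReal) := by
  have h1 : ∫⁻ x, ENNReal.ofReal (f x) ∂μ ≠ ⊤ := hf.lintegral_lt_top.ne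
  have h2 : ∫⁻ x, ENNReal.ofReal (-f x) ∂μ ≠ ⊤ := hf.neg.lintegral_lt_top.ne
  rw [integral_eq_lintegral_pos_part_sub_lintegral_neg_part hf, extIntegral, EReal.coe_sub,
    EReal.coe_ennreal_toReal h1, EReal.coe_ennreal_toReal h2]

/-- Test the supremum on the uniform measure along the orbit; `N` need not be the least period. -/
theorem birkhoffSum_nonpos_of_periodic {f : Shift A → ℝ} {S : Set ℕ} {b : ℝ}
    (hb : supIntegralOn f S ≤ (b : EReal)) {x : Shift A} (hx : x ∈ subshift A S) {N : ℕ}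
    (hN : 0 < N) (hper : (shiftMap A)^[N] x = x) :
    birkhoffSum (shiftMap A) (fun x => f x - b) N x ≤ 0 := by
  have hN0 : (N : ENNReal) ≠ 0 := by exact_mod_cast hN.ne'
  set μ : Measure (Shift A) :=
    (N : ENNReal)⁻¹ • ∑ k ∈ Finset.range N, Measure.dirac ((shiftMap A)^[k] x) with hμ
  have hprob : IsProbabilityMeasure μ := ⟨by
    simp [hμ, ENNReal.inv_mul_cancel hN0 (ENNReal.natCast_ne_top N)]⟩
  have hinv : MeasurePreserving (shiftMap A) μ μ := by
    refine ⟨measurable_shiftMap, ?_⟩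
    have hshift : ∑ k ∈ Finset.range N, Measure.dirac ((shiftMap A)^[k + 1] x) =
        ∑ k ∈ Finset.range N, Measure.dirac ((shiftMap A)^[k] x) := by
      obtain ⟨n, rfl⟩ := Nat.exists_eq_succ_of_ne_zero hN.ne'
      rw [Finset.sum_range_succ, Finset.sum_range_succ' _ n, hper]
      rfl
    rw [hμ, Measure.map_smul, ← Measure.mapₗ_apply_of_measurable measurable_shiftMap, map_sum]
    simp_rw [Measure.mapₗ_apply_of_measurable measurable_shiftMap,
      Measure.map_dirac' measurable_shiftMap, ← Function.iterate_succ_apply' (shiftMap A)]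
    rw [← hshift]
  have hnull : μ (subshift A S)ᶜ = 0 := by
    have hmem : ∀ k, (shiftMap A)^[k] x ∈ subshift A S := fun k i => by
      rw [iterate_shiftMap_apply]
      exact hx _
    simp [hμ, Measure.dirac_apply' _ (isClosed_subshift S).measurableSet.compl, hmem]
  have hint : Integrable f μ := by
    refine Integrable.smul_measure ?_ (ENNReal.inv_ne_top.2 hN0)
    exact integrable_finsetSum_measure.2 fun k _ => integrable_dirac (by simp)
  have hle : extIntegral f μ ≤ (b : EReal) :=
    (le_iSup₂_of_le μ ⟨⟨hprob, hinv⟩, hnull⟩ le_rfl : extIntegral f μ ≤ supIntegralOn f S).trans hb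
  rw [extIntegral_eq_integral hint, EReal.coe_le_coe_iff, hμ, integral_smul_measure,
    integral_finsetSum_measure (fun k _ => integrable_dirac (by simp))] at hle
  simp only [integral_dirac, ENNReal.toReal_inv, ENNReal.toReal_natCast, smul_eq_mul] at hle
  rw [inv_mul_le_iff₀ (by exact_mod_cast hN)] at hle
  simp only [birkhoffSum, Finset.sum_sub_distrib, Finset.sum_const, Finset.card_range, nsmul_eq_mul]
  linarith

/-- The integral of a measurable coboundary that is bounded below by an integrable function is
nonpositive. -/
theorem lintegral_coboundary_add_le {ν : Measure (Shift A)} [IsProbabilityMeasure ν]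
    (hν : MeasurePreserving (shiftMap A) ν ν) {φ g : Shift A → ℝ} (hφ : Measurable φ)
    (hg : Integrable g ν) (hgm : Measurable g) (hg0 : ∀ x, 0 ≤ g x)
    (hφg : ∀ x, φ x - g x ≤ φ (shiftMap A x)) :
    ∫⁻ x, ENNReal.ofReal (φ (shiftMap A x) - φ x + g x) ∂ν ≤ ∫⁻ x, ENNReal.ofReal (g x) ∂ν := by
  -- Truncations of `φ` are integrable, so their coboundaries integrate to zero. Truncation is
  -- monotone and 1-Lipschitz, hence keeps the lower bound `-g`, and Fatou applies.
  let T : ℕ → Shift A → ℝ := fun N x => max (min (φ x) N) (-N)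
  have hTm : ∀ N, Measurable (T N) := fun N => (hφ.min measurable_const).max measurable_const
  have hTi : ∀ N, Integrable (T N) ν := fun N =>
    Integrable.of_bound (hTm N).aestronglyMeasurable N (ae_of_all _ fun x => by
      rw [Real.norm_eq_abs, abs_le]
      exact ⟨le_max_right _ _, max_le (min_le_right _ _) (by
        have : (0 : ℝ) ≤ N := Nat.cast_nonneg N
        linarith)⟩)
  have hTσ : ∀ N, Integrable (fun x => T N (shiftMap A x)) ν := fun N =>
    hν.integrable_comp_of_integrable (hTi N)
  have hT0 : ∀ N x, 0 ≤ T N (shiftMap A x) - T N x + g x := by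
    intro N x
    have h1 := hφg x
    have h2 := hg0 x
    have : T N x ≤ T N (shiftMap A x) + g x := by
      simp only [T]
      refine max_le ?_ ?_
      · rcases le_total (φ (shiftMap A x)) N with h | h
        · rw [min_eq_left h]
          linarith [min_le_left (φ x) N, le_max_left (φ (shiftMap A x)) (-(N : ℝ))]
        · rw [min_eq_right h]
          linarith [min_le_right (φ x) N, le_max_left (N : ℝ) (-(N : ℝ))]
      · linarith [le_max_right (min (φ (shiftMap A x)) N) (-(N : ℝ))]
    linarith
  have hTint : ∀ N, ∫⁻ x, ENNReal.ofReal (T N (shiftMap A x) - T N x + g x) ∂ν =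
      ∫⁻ x, ENNReal.ofReal (g x) ∂ν := by
    intro N
    have hmap : ∫ x, T N (shiftMap A x) ∂ν = ∫ x, T N x ∂ν := by
      conv_rhs => rw [← hν.map_eq]
      exact (integral_map hν.measurable.aemeasurable (hTm N).aestronglyMeasurable).symm
    have hi : Integrable (fun x => T N (shiftMap A x) - T N x + g x) ν :=
      ((hTσ N).sub (hTi N)).add hg
    have hi' : Integrable (fun x => T N (shiftMap A x) - T N x) ν := (hTσ N).sub (hTi N)
    rw [← ofReal_integral_eq_lintegral_ofReal hi (ae_of_all _ (hT0 N)), ← ofReal_integral_eq_lintegral_ofReal hg (ae_of_all _ hg0)]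
    congr 1
    rw [integral_add hi' hg, integral_sub (hTσ N) (hTi N), hmap]
    ring
  have hlim : ∀ x, liminf (fun N => ENNReal.ofReal (T N (shiftMap A x) - T N x + g x)) atTop =
      ENNReal.ofReal (φ (shiftMap A x) - φ x + g x) := by
    intro x
    have hTe : ∀ y, ∀ᶠ N in atTop, T N y = φ y := by
      intro y
      obtain ⟨N₀, hN₀⟩ := exists_nat_ge |φ y|
      filter_upwards [eventually_ge_atTop N₀] with N hN
      have : |φ y| ≤ N := hN₀.trans (Nat.cast_le.2 hN)
      rw [abs_le] at this
      simp only [T]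
      rw [min_eq_left this.2, max_eq_left this.1]
    refine Tendsto.liminf_eq (tendsto_const_nhds.congr' ?_)
    filter_upwards [hTe x, hTe (shiftMap A x)] with N h1 h2
    rw [h1, h2]
  calc _ = ∫⁻ x, liminf (fun N => ENNReal.ofReal (T N (shiftMap A x) - T N x + g x)) atTop ∂ν := by
        simp only [hlim]
    _ ≤ liminf (fun N => ∫⁻ x, ENNReal.ofReal (T N (shiftMap A x) - T N x + g x) ∂ν) atTop :=
        lintegral_liminf_le fun N =>
          ((((hTm N).comp measurable_shiftMap).sub (hTm N)).add hgm).ennreal_ofReal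
    _ = _ := by simp only [hTint, liminf_const]

/-- With `g = (f - b)⁻`, the coboundary bound gives `∫ (f - b)⁺ ≤ ∫ (φ ∘ σ - φ + g)⁺ ≤ ∫ g`.
Equality of the outer terms forces the integrands to agree almost everywhere. -/
theorem extIntegral_le_of_subaction {f φ : Shift A → ℝ} (hf : Measurable f) (hφ : Measurable φ)
    {b : ℝ} (hsub : ∀ x, φ x + (f x - b) ≤ φ (shiftMap A x)) {ν : Measure (Shift A)}
    (hν : ν ∈ invariantMeasures A) :
    extIntegral f ν ≤ (b : EReal) ∧
      (extIntegral f ν = (b : EReal) → ∀ᵐ x ∂ν, φ (shiftMap A x) = φ x + (f x - b)) := by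
  obtain ⟨hprob, hinv⟩ := hν
  -- In `EReal`, subtracting `⊤` yields `⊥` whatever the positive part is.
  by_cases htop : ∫⁻ x, ENNReal.ofReal (-f x) ∂ν = ⊤
  · have hbot : extIntegral f ν = ⊥ := by
      rw [extIntegral, htop, EReal.coe_ennreal_top, EReal.sub_top]
    rw [hbot]
    exact ⟨bot_le, fun h => (EReal.bot_ne_coe b h).elim⟩
  let g : Shift A → ℝ := fun x => max (b - f x) 0
  have hgm : Measurable g := (measurable_const.sub hf).max measurable_const
  have hg0 : ∀ x, 0 ≤ g x := fun x => le_max_right _ _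
  have hgi : Integrable g ν := by
    rw [← lintegral_ofReal_ne_top_iff_integrable hgm.aestronglyMeasurable (ae_of_all _ hg0)]
    have h1 : ∫⁻ x, ENNReal.ofReal (g x) ∂ν ≤
        ∫⁻ x, (ENNReal.ofReal (-f x) + ENNReal.ofReal b) ∂ν := by
      refine lintegral_mono fun x => ?_
      rw [show g x = max (-f x + b) 0 by simp only [g]; congr 1; ring, ENNReal.ofReal_max,
        ENNReal.ofReal_zero]
      exact max_le ENNReal.ofReal_add_le bot_le
    refine ne_top_of_le_ne_top ?_ h1
    rw [lintegral_add_right _ measurable_const, lintegral_const]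
    exact ENNReal.add_ne_top.2 ⟨htop, by simp⟩
  have hfat := lintegral_coboundary_add_le hinv hφ hgi hgm hg0 fun x => by
    have := hsub x
    have := le_max_left (b - f x) 0
    simp only [g]
    linarith
  set h : Shift A → ℝ := fun x => f x - b with hh
  have hle : ∀ x, ENNReal.ofReal (h x) ≤
      ENNReal.ofReal (φ (shiftMap A x) - φ x + g x) := fun x => by
    refine ENNReal.ofReal_le_ofReal ?_
    have := hsub x
    have := hg0 x
    simp only [hh]
    linarith
  have hneg : ∫⁻ x, ENNReal.ofReal (-h x) ∂ν = ∫⁻ x, ENNReal.ofReal (g x) ∂ν := by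
    congr 1
    funext x
    simp only [hh, g, ENNReal.ofReal_max, neg_sub, ENNReal.ofReal_zero]
    exact (max_eq_left bot_le).symm
  have hgfin : ∫⁻ x, ENNReal.ofReal (g x) ∂ν ≠ ⊤ := hgi.lintegral_lt_top.ne
  have hpos : ∫⁻ x, ENNReal.ofReal (h x) ∂ν ≤ ∫⁻ x, ENNReal.ofReal (g x) ∂ν :=
    (lintegral_mono hle).trans hfat
  have hposfin : ∫⁻ x, ENNReal.ofReal (h x) ∂ν ≠ ⊤ := ne_top_of_le_ne_top hgfin hpos
  have hhm : Measurable h := hf.sub_const b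
  have hhi : Integrable h ν := by
    have h1 : Integrable (fun x => max (h x) 0) ν := by
      rw [← lintegral_ofReal_ne_top_iff_integrable (hhm.max (measurable_const (a := (0 : ℝ)))).aestronglyMeasurable
        (ae_of_all _ fun x => le_max_right _ _)]
      simpa [ENNReal.ofReal_max] using hposfin
    refine (h1.sub hgi).congr (ae_of_all _ fun x => ?_)
    simp only [Pi.sub_apply, g, hh]
    rcases le_total (f x) b with hx | hx
    · rw [max_eq_right (by linarith), max_eq_left (by linarith)]
      ring
    · rw [max_eq_left (by linarith), max_eq_right (by linarith)]
      ring
  have hfi : Integrable f ν := by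
    refine (hhi.add (integrable_const b)).congr (ae_of_all _ fun x => ?_)
    simp [hh]
  have hint : ∫ x, f x ∂ν = (∫⁻ x, ENNReal.ofReal (h x) ∂ν).toReal -
      (∫⁻ x, ENNReal.ofReal (g x) ∂ν).toReal + b := by
    rw [← hneg, ← integral_eq_lintegral_pos_part_sub_lintegral_neg_part hhi]
    simp [hh, integral_sub hfi (integrable_const b)]
  rw [extIntegral_eq_integral hfi, EReal.coe_le_coe_iff, EReal.coe_eq_coe_iff, hint]
  refine ⟨by linarith [ENNReal.toReal_mono hgfin hpos], fun heq => ?_⟩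
  have heq' : ∫⁻ x, ENNReal.ofReal (g x) ∂ν ≤ ∫⁻ x, ENNReal.ofReal (h x) ∂ν := by
    rw [← ENNReal.toReal_le_toReal hgfin hposfin]
    linarith
  have hae := ae_eq_of_ae_le_of_lintegral_le (ae_of_all _ hle) hposfin
    (((hφ.comp measurable_shiftMap).sub hφ).add hgm).ennreal_ofReal.aemeasurable
    (hfat.trans heq')
  filter_upwards [hae] with x hx
  have h1 := hsub x
  simp only [hh, g] at hx
  -- Where `f ≥ b`, `g` vanishes and the equality is immediate. Where `f ≤ b`, it gives only `φ ∘ σ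
  -- - φ ≤ f - b`, and the sub-action inequality gives the converse.
  rcases le_total b (f x) with hbf | hbf
  · rw [max_eq_right (by linarith), ENNReal.ofReal_eq_ofReal_iff (by linarith) (by linarith)] at hx
    linarith
  · rw [max_eq_left (by linarith), ENNReal.ofReal_of_nonpos (by linarith), eq_comm,
      ENNReal.ofReal_eq_zero] at hx
    linarith

/-! ### Maximizing measures -/

theorem ae_forall_iterate {ν : Measure (Shift A)} (hν : MeasurePreserving (shiftMap A) ν ν)
    {p : Shift A → Prop} (hp : ∀ᵐ x ∂ν, p x) : ∀ᵐ x ∂ν, ∀ n, p ((shiftMap A)^[n] x) :=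
  ae_all_iff.2 fun n => (hν.iterate n).quasiMeasurePreserving.ae hp

theorem birkhoffSum_eq_of_subaction_eq {φ h : Shift A → ℝ} {x : Shift A}
    (hx : ∀ n, φ ((shiftMap A)^[n + 1] x) = φ ((shiftMap A)^[n] x) + h ((shiftMap A)^[n] x))
    (n : ℕ) : φ ((shiftMap A)^[n] x) = φ x + birkhoffSum (shiftMap A) h n x := by
  induction n with
  | zero => simp
  | succ n ih => rw [hx, ih, birkhoffSum_succ, add_assoc]

/-- Along an orbit on which the sub-action inequality is an equality, a recurrent symbol is less
than `I₂`. -/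
theorem ExcursionBounds.lt_of_frequently {f : Shift A → ℝ} {β ε : ℝ} {I₁ I₂ : ℕ}
    {w : ℕ → ℕ → List ℕ} (H : ExcursionBounds A f β ε I₁ I₂ w) {φ : Shift A → ℝ} {V : ℝ}
    (hosc : ∀ x y : Shift A, x.1 0 = y.1 0 → φ x - φ y ≤ V)
    (hgap : ∀ (x : Shift A) (m k : ℕ), x.1 0 < I₁ → x.1 (1 + m) < I₁ →
        (∀ i, 0 < i → i < 1 + m → I₁ ≤ x.1 i) → 0 < k → k < 1 + m →
        φ x + birkhoffSum (shiftMap A) (fun x => f x - β) (1 + m) x +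
          (constC f β ε w I₁ - f ((shiftMap A)^[k] x)) ≤ φ ((shiftMap A)^[1 + m] x))
    {x : Shift A} {j : ℕ} (hI : I₁ ≤ I₂)
    (heq : ∀ n, φ ((shiftMap A)^[n + 1] x) =
      φ ((shiftMap A)^[n] x) + (f ((shiftMap A)^[n] x) - β))
    (hfreq : ∃ᶠ n in atTop, x.1 n = j) : j < I₂ := by
  have hsum : ∀ s n, φ ((shiftMap A)^[n] ((shiftMap A)^[s] x)) = φ ((shiftMap A)^[s] x) +
      birkhoffSum (shiftMap A) (fun x => f x - β) n ((shiftMap A)^[s] x) := fun s n =>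
    birkhoffSum_eq_of_subaction_eq (h := fun x => f x - β) (fun n => by
      simpa only [← Function.iterate_add_apply, add_right_comm] using heq (n + s)) n
  by_contra hj
  rw [not_lt] at hj
  rw [frequently_atTop] at hfreq
  -- Otherwise the orbit eventually stays above `I₁`, losing more than `ε` per step, whereas `φ`
  -- changes by at most `V` between two visits to `j`. Visits more than `V / ε` apart are
  -- contradictory.
  have hret : ∀ N, ∃ n ≥ N, x.1 n < I₁ := by
    by_contra! hcon
    obtain ⟨N, hN⟩ := hcon
    obtain ⟨s, hsN, hs⟩ := hfreq N
    obtain ⟨M, hM⟩ := exists_nat_gt (V / ε)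
    obtain ⟨t, htM, ht⟩ := hfreq (s + M)
    obtain ⟨l, rfl⟩ := Nat.exists_eq_add_of_le (show s ≤ t by omega)
    have h1 : birkhoffSum (shiftMap A) (fun x => f x - β) l ((shiftMap A)^[s] x) ≤ l * (-ε) :=
      birkhoffSum_le_mul fun k _ => by
        have := H.lt_of_ge ((shiftMap A)^[k] ((shiftMap A)^[s] x)) (by
          rw [← Function.iterate_add_apply, iterate_shiftMap_apply]
          exact hN _ (by omega))
        linarith
    have h2 := hsum s l
    have h3 := hosc ((shiftMap A)^[s] x) ((shiftMap A)^[l] ((shiftMap A)^[s] x)) (by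
      rw [← Function.iterate_add_apply, iterate_shiftMap_apply, iterate_shiftMap_apply, add_zero,
        add_zero, hs, add_comm, ht])
    have h4 : V < M * ε := (div_lt_iff₀ H.eps_pos).1 hM
    have h5 : (M : ℝ) * ε ≤ l * ε :=
      mul_le_mul_of_nonneg_right (Nat.cast_le.2 (by omega)) H.eps_pos.le
    linarith
  -- A visit to `j` now lies in an excursion between two symbols below `I₁`, across which `hgap` is
  -- strict, against `heq`.
  obtain ⟨s₀, -, hs₀⟩ := hret 0
  obtain ⟨k₀, hk₀, hk₀j⟩ := hfreq (s₀ + 1)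
  obtain ⟨k, rfl⟩ := Nat.exists_eq_add_of_le (show s₀ ≤ k₀ by omega)
  obtain ⟨s, hsk, hs, hexc₁⟩ := exists_last_lt (a := fun i => x.1 (s₀ + i)) (I := I₁) (n := k) hs₀
    (by omega)
  obtain ⟨t₀, ht₀, ht₀I⟩ := hret (s₀ + k)
  have hex : ∃ n, x.1 (s₀ + k + n) < I₁ := ⟨t₀ - (s₀ + k), by rwa [Nat.add_sub_cancel' ht₀]⟩
  obtain ⟨t, ht, hmin⟩ : ∃ t, x.1 (s₀ + k + t) < I₁ ∧ ∀ i < t, ¬ x.1 (s₀ + k + i) < I₁ :=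
    ⟨Nat.find hex, Nat.find_spec hex, fun i hi => Nat.find_min hex hi⟩
  have ht0 : 0 < t := by
    rcases Nat.eq_zero_or_pos t with rfl | h
    · rw [add_zero, hk₀j] at ht
      omega
    · exact h
  obtain ⟨l, rfl⟩ := Nat.exists_eq_add_of_lt hsk
  have hgap' := hgap ((shiftMap A)^[s₀ + s] x) (l + t) (l + 1)
    (by rw [iterate_shiftMap_apply]; exact hs)
    (by rw [iterate_shiftMap_apply, show s₀ + s + (1 + (l + t)) = s₀ + (s + l + 1) + t by omega]
        exact ht)
    (fun i hi₁ hi₂ => by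
      rw [iterate_shiftMap_apply]
      rcases lt_or_ge i (l + 1) with hi | hi
      · rw [add_assoc]
        exact hexc₁ (s + i) (by omega) (by omega)
      · obtain ⟨r, rfl⟩ := Nat.exists_eq_add_of_le hi
        rw [show s₀ + s + (l + 1 + r) = s₀ + (s + l + 1) + r by omega]
        exact not_lt.1 (hmin r (by omega)))
    (by omega) (by omega)
  have hC := H.lt_constC ((shiftMap A)^[l + 1] ((shiftMap A)^[s₀ + s] x)) (by
    rw [← Function.iterate_add_apply, iterate_shiftMap_apply,
      show l + 1 + (s₀ + s) + 0 = s₀ + (s + l + 1) by omega, hk₀j]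
    exact hj)
  rw [hsum] at hgap'
  linarith

end CountableMarkov

theorem theorem2 (A : ℕ → ℕ → Fin 2) (hA : IrreducibleOn A Set.univ)
    (f : Shift A → ℝ) (hf : totalVariation f ≠ ⊤)
    (β : ℝ) (hβ : supIntegral f = (β : EReal))
    (ε : ℝ) (hε : 0 < ε)
    (I₁ I₂ : ℕ) (hI₁ : 0 < I₁) (hI₂ : I₁ < I₂)
    (w : ℕ → ℕ → List ℕ) (hw : ∀ i < I₁, ∀ j < I₁, Connects A i (w i j) j)
    (h₁ : ∀ j ≥ I₁, cylinderSup f j < ((β - ε : ℝ) : EReal))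
    (h₂ : ∀ j ≥ I₂, cylinderSup f j < (constC f β ε w I₁ : EReal)) :
    ∃ S : Finset ℕ, IrreducibleOn A (S : Set ℕ) ∧
      supIntegralOn f (S : Set ℕ) = (β : EReal) ∧
      ∀ ν ∈ invariantMeasures A, extIntegral f ν = (β : EReal) →
        ν.support ⊆ subshift A (S : Set ℕ) := by
  have H : ExcursionBounds A f β ε I₁ I₂ w :=
    ⟨hA, hf, hε, hI₁, hw, fun x hx => lt_of_cylinderSup_lt (h₁ _ hx) rfl,
      fun x hx => lt_of_cylinderSup_lt (h₂ _ hx) rfl⟩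
  have hcont := continuous_of_totalVariation_ne_top hf
  choose v hv using fun i j => hA i trivial j trivial
  -- Keeping `w` below `I₁` ensures `𝒜₁ ⊆ S`, so the bypassing words stay inside `S`.
  let w' : ℕ → ℕ → List ℕ := fun i j => if i < I₁ ∧ j < I₁ then w i j else v i j
  have hw' : ∀ i < I₂, ∀ j < I₂, Connects A i (w' i j) j := by
    intro i _ j _
    by_cases h : i < I₁ ∧ j < I₁
    · simpa only [w', if_pos h] using hw i h.1 j h.2
    · simpa only [w', if_neg h] using (hv i j).2
  set S := completedAlphabet w' I₂
  have hS₂ : Finset.range I₂ ⊆ S := fun i hi => mem_completedAlphabet_of_lt (Finset.mem_range.1 hi)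
  have hS₁ : completedAlphabet w I₁ ⊆ S := by
    intro s hs
    rcases mem_completedAlphabet hs with hs | ⟨i, hi, j, hj, hs⟩
    · exact mem_completedAlphabet_of_lt (hs.trans hI₂)
    · refine mem_completedAlphabet_of_mem (hi.trans hI₂) (hj.trans hI₂) ?_
      simpa only [w', if_pos (And.intro hi hj)] using hs
  have hle : supIntegralOn f (S : Set ℕ) ≤ (β : EReal) := by
    rw [← hβ]
    exact iSup₂_le fun μ hμ => le_iSup₂_of_le μ hμ.1 le_rfl
  refine ⟨S, irreducibleOn_completedAlphabet hw', le_antisymm hle ?_, fun ν hν hmax => ?_⟩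
  · by_contra hlt
    rw [not_le] at hlt
    have hlt' : max (supIntegralOn f (S : Set ℕ)) ((β - ε : ℝ) : EReal) < (β : EReal) :=
      max_lt hlt (EReal.coe_lt_coe_iff.2 (by linarith))
    -- Such a `b` dominates the integrals over `Σ_A(S)`, and the sub-action makes it dominate all of
    -- them, although `b < β`.
    obtain ⟨b, hb₁, hb₂⟩ := EReal.lt_iff_exists_real_btwn.1 hlt'
    obtain ⟨φ, hφ, hsub, -⟩ := H.exists_subaction
      (EReal.coe_le_coe_iff.1 ((le_max_right _ _).trans hb₁.le))
      (EReal.coe_lt_coe_iff.1 hb₂).le hS₁ hS₂ fun x hx N hN hper =>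
        birkhoffSum_nonpos_of_periodic ((le_max_left _ _).trans hb₁.le) hx hN hper
    refine hb₂.not_ge ?_
    rw [← hβ]
    exact iSup₂_le fun μ hμ =>
      (extIntegral_le_of_subaction hcont.measurable hφ.measurable hsub hμ).1
  · obtain ⟨φ, hφ, hsub, hosc, hgap⟩ := H.exists_subaction (b := β) (by linarith) le_rfl hS₁ hS₂
      fun x hx N hN hper => birkhoffSum_nonpos_of_periodic hle hx hN hper
    have heq := ae_forall_iterate hν.2
      ((extIntegral_le_of_subaction hcont.measurable hφ.measurable hsub hν).2 hmax)
    have := hν.1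
    -- Poincaré recurrence for the cylinder `[j]`.
    have hrec : ∀ j, ∀ᵐ x ∂ν, x.1 0 = j → ∃ᶠ n in Filter.atTop, x.1 n = j := by
      intro j
      have hm : MeasurableSet {x : Shift A | x.1 0 = j} :=
        (((continuous_apply 0).comp continuous_subtype_val).measurable :
          Measurable fun x : Shift A => x.1 0) (measurableSet_singleton j)
      filter_upwards [hν.2.conservative.ae_mem_imp_frequently_image_mem hm.nullMeasurableSet]
        with x hx hxj
      refine (hx hxj).mono fun n hn => ?_
      change ((shiftMap A)^[n] x).1 0 = j at hn
      rwa [iterate_shiftMap_apply, add_zero] at hn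
    have hsymb : ∀ᵐ x ∂ν, x.1 0 < I₂ := by
      filter_upwards [heq, MeasureTheory.ae_all_iff.2 hrec] with x hx hxr
      exact H.lt_of_frequently hosc hgap hI₂.le
        (fun n => by rw [Function.iterate_succ_apply', hx n]) (hxr _ rfl)
    refine Measure.support_subset_of_isClosed (isClosed_subshift _) ?_
    filter_upwards [ae_forall_iterate hν.2 hsymb] with x hx i
    have := hx i
    rw [iterate_shiftMap_apply, add_zero] at this
    exact hS₂ (Finset.mem_range.2 this)
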